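/- Let $F$ be a field of characteristic $0$ and let $A_1=F\langle x,y \mid yx-xy=1\rangle$ be the first Weyl algebra. Let $\alpha$ be the exchange involution on $A_1$, i.e. the $F$-linear antiautomorphism with $\alpha(x)=y$, $\alpha(y)=x$; write $u^*=\alpha(u)$. Let $\Theta:A_1\to F[X,Y]$ be the $F$-linear isomorphism $\sum a_{ij}x^iy^j\mapsto\sum a_{ij}X^iY^j$. For $0\neq u\in A_1$ with $\Theta(u)=\sum a_{ij}X^iY^j$, the $(1,1)$-degree of $u$ is $\nu_{1,1}(u)=\max\{i+j : a_{ij}\neq 0\}$, and the $(1,1)$-leading term of $u$ is $l_{1,1}(u)=\sum_{i+j=\nu_{1,1}(u)}a_{ij}X^iY^j$, which is regarded as an element of $A_1$ via $\Theta^{-1}$. Let $f$ be an $\alpha$-endomorphism of $A_1$, i.e. an $F$-algebra endomorphism of $A_1$ with $f(\alpha(w))=\alpha(f(w))$ for all $w\in A_1$. Let $P=f(x)$, and suppose that $f$ has degree $>1$, i.e. $\nu_{1,1}(P)>1$. Then $f(y)=P^*$, and the $(1,1)$-leading term $L=\Theta^{-1}(l_{1,1}(P))$ of $P$ is symmetric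 or antisymmetric with respect to $\alpha$, i.e. $\alpha(L)=L$ or $\alpha(L)=-L$. -/

import Mathlib

/-- The defining relation `y x = x y + 1` on the free algebra in the generators
`x = ι 0` and `y = ι 1`. -/
inductive WeylRel (F : Type*) [Field F] : FreeAlgebra F (Fin 2) → FreeAlgebra F (Fin 2) → Prop
  | comm : WeylRel F (FreeAlgebra.ι F 1 * FreeAlgebra.ι F 0)
      (FreeAlgebra.ι F 0 * FreeAlgebra.ι F 1 + 1)

/-- The first Weyl algebra `A₁(F) = F⟨x, y | yx - xy = 1⟩`. -/
abbrev WeylA1 (F : Type*) [Field F] : Type _ := RingQuot (WeylRel F)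

namespace WeylA1

variable {F : Type*} [Field F]

/-- The generator `x`. -/
def x : WeylA1 F := RingQuot.mkAlgHom F (WeylRel F) (FreeAlgebra.ι F 0)

/-- The generator `y`. -/
def y : WeylA1 F := RingQuot.mkAlgHom F (WeylRel F) (FreeAlgebra.ι F 1)

theorem y_mul_x : (y * x : WeylA1 F) = x * y + 1 := by
  have h := RingQuot.mkAlgHom_rel F (WeylRel.comm (F := F))
  simpa [x, y] using h

/-- The universal property of `A₁(F)`: two elements `a, b` of an `F`-algebra with
`b a = a b + 1` give an algebra homomorphism with `x ↦ a`, `y ↦ b`. -/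
def lift {B : Type*} [Ring B] [Algebra F B] (a b : B) (h : b * a = a * b + 1) :
    WeylA1 F →ₐ[F] B :=
  RingQuot.liftAlgHom F ⟨FreeAlgebra.lift F ![a, b], by
    rintro _ _ ⟨⟩
    simpa using h⟩

@[simp] theorem lift_x {B : Type*} [Ring B] [Algebra F B] (a b : B) (h : b * a = a * b + 1) :
    lift (F := F) a b h x = a := by
  simp [lift, x]

@[simp] theorem lift_y {B : Type*} [Ring B] [Algebra F B] (a b : B) (h : b * a = a * b + 1) :
    lift (F := F) a b h y = b := by
  simp [lift, y]

/-- Induction principle: `A₁(F)` is generated by `x` and `y`. -/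
theorem induction {p : WeylA1 F → Prop} (hF : ∀ c : F, p (algebraMap F _ c)) (hx : p x)
    (hy : p y) (hmul : ∀ a b, p a → p b → p (a * b)) (hadd : ∀ a b, p a → p b → p (a + b))
    (u : WeylA1 F) : p u := by
  obtain ⟨a, rfl⟩ := RingQuot.mkAlgHom_surjective F (WeylRel F) u
  induction a using FreeAlgebra.induction with
  | grade0 c => simpa using hF c
  | grade1 i =>
    fin_cases i
    · exact hx
    · exact hy
  | mul a b ha hb => rw [map_mul]; exact hmul _ _ ha hb
  | add a b ha hb => rw [map_add]; exact hadd _ _ ha hb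

/-! ### The exchange involution -/

/-- The exchange involution as a homomorphism to the opposite algebra. -/
def exchangeHom : WeylA1 F →ₐ[F] (WeylA1 F)ᵐᵒᵖ :=
  lift (MulOpposite.op y) (MulOpposite.op x) (by
    rw [← MulOpposite.op_mul, ← MulOpposite.op_mul, y_mul_x]; simp)

/-- The exchange involution `α` of `A₁(F)`: the antiendomorphism with `α x = y` and `α y = x`. -/
def exchange : WeylA1 F →ₗ[F] WeylA1 F :=
  (MulOpposite.opLinearEquiv F).symm.toLinearMap ∘ₗ exchangeHom.toLinearMap

@[simp] theorem exchange_x : exchange (x : WeylA1 F) = y := by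
  simp [exchange, exchangeHom]

@[simp] theorem exchange_y : exchange (y : WeylA1 F) = x := by
  simp [exchange, exchangeHom]

theorem exchange_mul (u v : WeylA1 F) : exchange (u * v) = exchange v * exchange u := by
  simp [exchange]

theorem exchange_algebraMap (c : F) :
    exchange (algebraMap F (WeylA1 F) c) = algebraMap F (WeylA1 F) c := by
  simp [exchange, MulOpposite.algebraMap_apply]

theorem exchange_exchange (u : WeylA1 F) : exchange (exchange u) = u := by
  induction u using WeylA1.induction with
  | hF c => simp only [exchange_algebraMap]
  | hx => simp
  | hy => simp
  | hmul a b ha hb => simp only [exchange_mul, ha, hb]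
  | hadd a b ha hb => simp only [map_add, ha, hb]

/-- `u` is symmetric with respect to the exchange involution. -/
def IsSymmetric (u : WeylA1 F) : Prop := exchange u = u

/-- `u` is antisymmetric with respect to the exchange involution. -/
def IsAntisymmetric (u : WeylA1 F) : Prop := exchange u = -u

/-- An `α`-endomorphism of `A₁(F)`: an `F`-algebra endomorphism commuting with `α`. -/
def IsAlphaEndomorphism (f : WeylA1 F →ₐ[F] WeylA1 F) : Prop :=
  ∀ w : WeylA1 F, f (exchange w) = exchange (f w)

/-! ### The linear isomorphism `Θ : A₁(F) → F[X, Y]` -/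

/-- The linear map `F[X, Y] → A₁(F)` sending `∑ aᵢⱼ XⁱYʲ` to `∑ aᵢⱼ xⁱyʲ`. -/
noncomputable def ofPoly : MvPolynomial (Fin 2) F →ₗ[F] WeylA1 F :=
  (MvPolynomial.basisMonomials (Fin 2) F).constr F fun m => x ^ m 0 * y ^ m 1

theorem ofPoly_monomial (m : Fin 2 →₀ ℕ) (c : F) :
    ofPoly (MvPolynomial.monomial m c) = c • (x ^ m 0 * y ^ m 1 : WeylA1 F) := by
  have h : MvPolynomial.monomial m c = c • MvPolynomial.basisMonomials (Fin 2) F m := by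
    simp [MvPolynomial.smul_monomial]
  rw [h, map_smul, ofPoly, Module.Basis.constr_basis]

theorem y_mul_x_pow (n : ℕ) :
    (y * x ^ n : WeylA1 F) = x ^ n * y + (n : F) • x ^ (n - 1) := by
  induction n with
  | zero => simp
  | succ n ih =>
    rw [pow_succ, ← mul_assoc, ih, add_mul, mul_assoc, y_mul_x]
    rcases n with _ | n
    · simp
    · simp only [Nat.add_sub_cancel, smul_mul_assoc, ← pow_succ]
      push_cast
      rw [mul_add, mul_one, ← mul_assoc, ← pow_succ, add_smul ((n : F) + 1), one_smul]
      abel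

/-- The left regular representation of `A₁(F)`, written on `F[X, Y]`:
`x` acts as `X` and `y` acts as `Y + ∂/∂X`. -/
noncomputable def polyRep : WeylA1 F →ₐ[F] Module.End F (MvPolynomial (Fin 2) F) :=
  lift (LinearMap.mulLeft F (MvPolynomial.X 0))
    (LinearMap.mulLeft F (MvPolynomial.X 1) + (MvPolynomial.pderiv 0).toLinearMap) (by
      ext1 m
      ext1
      simp [Derivation.leibniz]
      ring)

theorem ofPoly_polyRep (u : WeylA1 F) (p : MvPolynomial (Fin 2) F) :
    ofPoly (polyRep u p) = u * ofPoly p := by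
  induction u using WeylA1.induction generalizing p with
  | hF c => simp [Algebra.algebraMap_eq_smul_one]
  | hx =>
    induction p using MvPolynomial.induction_on' with
    | monomial m c =>
      simp only [polyRep, lift_x, LinearMap.mulLeft_apply, MvPolynomial.X,
        MvPolynomial.monomial_mul, ofPoly_monomial, one_mul]
      simp [pow_add, mul_assoc]
    | add p q hp hq => simp only [map_add, mul_add, hp, hq]
  | hy =>
    induction p using MvPolynomial.induction_on' with
    | monomial m c =>
      simp only [polyRep, lift_y, LinearMap.add_apply, LinearMap.mulLeft_apply, MvPolynomial.X,
        MvPolynomial.monomial_mul, ofPoly_monomial, one_mul, map_add,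
        Derivation.coeFn_coe, MvPolynomial.pderiv_monomial, mul_smul_comm]
      rw [← mul_assoc, y_mul_x_pow, add_mul, smul_add, mul_assoc, ← pow_succ']
      simp [add_comm 1, mul_smul]
    | add p q hp hq => simp only [map_add, mul_add, hp, hq]
  | hmul a b ha hb => rw [map_mul, Module.End.mul_apply, ha, hb, mul_assoc]
  | hadd a b ha hb => rw [map_add, LinearMap.add_apply, map_add, ha, hb, add_mul]

theorem polyRep_ofPoly (p : MvPolynomial (Fin 2) F) : polyRep (ofPoly p) 1 = p := by
  have hy : ∀ n : ℕ, polyRep (y ^ n : WeylA1 F) 1 = MvPolynomial.X 1 ^ n := by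
    intro n
    induction n with
    | zero => simp
    | succ n ih =>
      rw [pow_succ', map_mul, Module.End.mul_apply, ih]
      simp [polyRep, Derivation.leibniz_pow, pow_succ']
  have hx : ∀ (n : ℕ) (q : MvPolynomial (Fin 2) F),
      polyRep (x ^ n : WeylA1 F) q = MvPolynomial.X 0 ^ n * q := by
    intro n q
    induction n with
    | zero => simp
    | succ n ih =>
      rw [pow_succ', map_mul, Module.End.mul_apply, ih]
      simp [polyRep, pow_succ', mul_assoc]
  induction p using MvPolynomial.induction_on' with
  | monomial m c =>
    rw [ofPoly_monomial, map_smul, map_mul, LinearMap.smul_apply, Module.End.mul_apply, hy, hx,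
      MvPolynomial.monomial_eq, MvPolynomial.smul_eq_C_mul, Finsupp.prod_fintype _ _ (by simp)]
    simp [Fin.prod_univ_two]
  | add p q hp hq => rw [map_add, map_add, LinearMap.add_apply, hp, hq]

theorem ofPoly_bijective : Function.Bijective (ofPoly (F := F)) := by
  refine ⟨Function.LeftInverse.injective (g := fun u => polyRep u 1) polyRep_ofPoly, fun u =>
    ⟨polyRep u 1, ?_⟩⟩
  have h1 : ofPoly (1 : MvPolynomial (Fin 2) F) = 1 := by
    have := ofPoly_monomial (F := F) 0 1
    simpa using this
  rw [ofPoly_polyRep, h1, mul_one]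

/-- The `F`-linear isomorphism `Θ : A₁(F) → F[X, Y]`, `Θ (∑ aᵢⱼ xⁱyʲ) = ∑ aᵢⱼ XⁱYʲ`. -/
noncomputable def theta : WeylA1 F ≃ₗ[F] MvPolynomial (Fin 2) F :=
  (LinearEquiv.ofBijective ofPoly ofPoly_bijective).symm

theorem theta_x_pow_mul_y_pow (i j : ℕ) :
    theta (x ^ i * y ^ j : WeylA1 F) = MvPolynomial.X 0 ^ i * MvPolynomial.X 1 ^ j := by
  rw [theta, LinearEquiv.symm_apply_eq, LinearEquiv.ofBijective_apply]
  have h : (MvPolynomial.X 0 ^ i * MvPolynomial.X 1 ^ j : MvPolynomial (Fin 2) F) =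
      MvPolynomial.monomial (Finsupp.single 0 i + Finsupp.single 1 j) 1 := by
    simp [MvPolynomial.X_pow_eq_monomial, MvPolynomial.monomial_mul]
  rw [h, ofPoly_monomial]
  simp

/-! ### `(r, s)`-degree and `(r, s)`-leading term -/

/-- `ν_{r,s}(i, j) = r i + s j` for the exponent `m = (i, j)` of a monomial `XⁱYʲ`. -/
def nuExp (r s : ℤ) (m : Fin 2 →₀ ℕ) : ℤ := r * m 0 + s * m 1

/-- The `(r, s)`-degree of `p ∈ F[X, Y]`: the maximum of `r i + s j` over the support of `p`
(and `⊥` for `p = 0`). -/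
def nuPoly (r s : ℤ) (p : MvPolynomial (Fin 2) F) : WithBot ℤ :=
  p.support.sup fun m => (nuExp r s m : WithBot ℤ)

/-- The `(r, s)`-leading term of `p ∈ F[X, Y]`: the sum of the terms of `p` of maximal
`(r, s)`-degree. -/
noncomputable def leadPoly (r s : ℤ) (p : MvPolynomial (Fin 2) F) : MvPolynomial (Fin 2) F :=
  ∑ m ∈ p.support with (nuExp r s m : WithBot ℤ) = nuPoly r s p,
    MvPolynomial.monomial m (p.coeff m)

/-- The `(r, s)`-degree of `u ∈ A₁(F)`. -/
noncomputable def nu (r s : ℤ) (u : WeylA1 F) : WithBot ℤ := nuPoly r s (theta u)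

/-- The `(r, s)`-leading term of `u ∈ A₁(F)`, an element of `F[X, Y]`. -/
noncomputable def lead (r s : ℤ) (u : WeylA1 F) : MvPolynomial (Fin 2) F :=
  leadPoly r s (theta u)

/-- The degree of an endomorphism `f` of `A₁(F)`: the `(1, 1)`-degree of `f x`. -/
noncomputable def endDegree (f : WeylA1 F →ₐ[F] WeylA1 F) : WithBot ℤ := nu 1 1 (f x)

end WeylA1

/-! Applying `f` to `yx - xy = 1` gives `[P^*, P] = 1`. Transported along `Θ`, the product of `A₁`
is the commutative product plus `∂_Y u · ∂_X v` plus terms of degree lower by at least 4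
(`theta_mul_mem`). A commutator therefore has the Jacobian bracket as its top part
(`theta_commutator_mem`).

Let `l` be the leading form of `P`, of degree `n > 1`. The leading form of `P^*` is `l` with its
variables swapped. The bracket of these two forms is homogeneous of degree `2n - 2 > 0`, while the
commutator is the constant `1`, so the bracket vanishes. Binary forms of equal positive degree with
zero Jacobian are proportional in characteristic zero, so the swap sends `l` to `c • l`. The swap is
an involution, so `c² = 1` and `c = ±1`. -/

namespace MvPolynomial

/-! ### The total degree filtration. -/

variable {σ : Type*} {F : Type*} [Field F]

/-- Polynomials of total degree at most `k`, where `k` may be negative. -/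
def degLE (σ F : Type*) [Field F] (k : ℤ) : Submodule F (MvPolynomial σ F) where
  carrier := {p | ∀ m, p.coeff m ≠ 0 → (m.degree : ℤ) ≤ k}
  zero_mem' := by simp
  add_mem' := by
    intro p q hp hq m hm
    by_cases h : p.coeff m = 0
    · exact hq m (by simpa [h] using hm)
    · exact hp m h
  smul_mem' := by
    intro c p hp m hm
    exact hp m (by rintro h; simp [h] at hm)

theorem degLE_mono {k l : ℤ} (h : k ≤ l) : degLE σ F k ≤ degLE σ F l :=
  fun _ hp m hm => (hp m hm).trans h

theorem monomial_mem_degLE {k : ℤ} {m : σ →₀ ℕ} (h : (m.degree : ℤ) ≤ k) (c : F) :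
    monomial m c ∈ degLE σ F k := by
  classical
  intro n hn
  rw [coeff_monomial] at hn
  by_cases hmn : m = n
  · exact hmn ▸ h
  · simp [hmn] at hn

/-- A linear map respects the filtration as soon as it does so on monomials. -/
theorem map_mem_degLE {τ : Type*} {i k : ℤ} (L : MvPolynomial σ F →ₗ[F] MvPolynomial τ F)
    (h : ∀ m : σ →₀ ℕ, (m.degree : ℤ) ≤ i → L (monomial m 1) ∈ degLE τ F k)
    {p : MvPolynomial σ F} (hp : p ∈ degLE σ F i) : L p ∈ degLE τ F k := by
  rw [← support_sum_monomial_coeff p, map_sum]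
  refine Submodule.sum_mem _ fun m hm => ?_
  have : monomial m (p.coeff m) = p.coeff m • monomial m (1 : F) := by
    simp [smul_monomial]
  rw [this, map_smul]
  exact Submodule.smul_mem _ _ (h m (hp m (mem_support_iff.1 hm)))

theorem mul_mem_degLE {i j : ℤ} {p q : MvPolynomial σ F} (hp : p ∈ degLE σ F i)
    (hq : q ∈ degLE σ F j) : p * q ∈ degLE σ F (i + j) := by
  refine map_mem_degLE (LinearMap.mulRight F q) (fun m hm => ?_) hp
  refine map_mem_degLE (LinearMap.mulLeft F (monomial m 1)) (fun n hn => ?_) hq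
  rw [LinearMap.mulLeft_apply, monomial_mul]
  exact monomial_mem_degLE (by rw [map_add]; push_cast; omega) _

theorem pderiv_mem_degLE (s : σ) {i : ℤ} {p : MvPolynomial σ F} (hp : p ∈ degLE σ F i) :
    pderiv s p ∈ degLE σ F (i - 1) := by
  refine map_mem_degLE (pderiv s).toLinearMap (fun m hm => ?_) hp
  simp only [Derivation.coeFn_coe, pderiv_monomial, one_mul]
  by_cases h : m s = 0
  · simp [h]
  · refine monomial_mem_degLE ?_ _
    have h1 : (m - Finsupp.single s 1) + Finsupp.single s 1 = m :=
      tsub_add_cancel_of_le (by simpa using Nat.one_le_iff_ne_zero.2 h)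
    have h2 := congrArg Finsupp.degree h1
    rw [map_add, Finsupp.degree_single] at h2
    omega

theorem X_pow_mem_degLE (s : σ) (n : ℕ) : (X s ^ n : MvPolynomial σ F) ∈ degLE σ F n := by
  rw [X_pow_eq_monomial]
  exact monomial_mem_degLE (by simp) _

theorem rename_mem_degLE {τ : Type*} (f : σ → τ) {i : ℤ} {p : MvPolynomial σ F}
    (hp : p ∈ degLE σ F i) : rename f p ∈ degLE τ F i := by
  refine map_mem_degLE (rename f).toLinearMap (fun m hm => ?_) hp
  simp only [AlgHom.toLinearMap_apply, rename_monomial]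
  exact monomial_mem_degLE (by rwa [Finsupp.degree_mapDomain]) _

theorem IsHomogeneous.mem_degLE {n : ℕ} {p : MvPolynomial σ F} (hp : p.IsHomogeneous n) :
    p ∈ degLE σ F n := fun m hm => by
  by_contra h
  exact hm (hp.coeff_eq_zero (by omega))

theorem IsHomogeneous.eq_zero_of_mem_degLE {n : ℕ} {k : ℤ} {p : MvPolynomial σ F}
    (hp : p.IsHomogeneous n) (hk : p ∈ degLE σ F k) (hkn : k < n) : p = 0 := by
  ext m
  by_contra hm
  have h1 := hk m (by simpa using hm)
  exact hm (by simpa using hp.coeff_eq_zero (by omega))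

/-- The operator `X s * ∂_s` is diagonal on monomials, so it never enlarges the support; its
eigenvalue at the leading monomial recovers the leading exponent. -/
theorem coeff_X_mul_pderiv (s : σ) (p : MvPolynomial σ F) (m : σ →₀ ℕ) :
    coeff m (X s * pderiv s p) = m s * coeff m p := by
  classical
  induction p using MvPolynomial.induction_on' with
  | monomial n c =>
    rw [X_mul_pderiv_monomial, coeff_smul, coeff_monomial]
    by_cases h : n = m <;> simp [h]
  | add p q hp hq => simp only [map_add, mul_add, coeff_add, hp, hq]

/-- Two polynomials over a field of characteristic zero with equal logarithmic derivatives are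
proportional. -/
theorem exists_eq_smul_of_mul_pderiv_eq [LinearOrder σ] [WellFoundedGT σ] [CharZero F]
    {p q : MvPolynomial σ F} (hq : q ≠ 0)
    (h : ∀ s, p * pderiv s q = q * pderiv s p) : ∃ c : F, p = c • q := by
  set o : MonomialOrder σ := MonomialOrder.lex
  have hle : ∀ (s : σ) (r : MvPolynomial σ F),
      o.toSyn (o.degree (X s * pderiv s r)) ≤ o.toSyn (o.degree r) := by
    intro s r
    rw [o.degree_le_iff]
    intro m hm
    refine o.le_degree ?_
    rw [mem_support_iff, coeff_X_mul_pderiv] at hm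
    exact mem_support_iff.2 (right_ne_zero_of_mul hm)
  -- Comparing coefficients at the sum of the two leading exponents gives equality of the exponents
  -- in `F`, hence in `ℕ` by characteristic zero.
  have key : ∀ r : MvPolynomial σ F, r ≠ 0 → (∀ s, r * pderiv s q = q * pderiv s r) →
      o.degree r = o.degree q := by
    intro r hr hrq
    ext s
    have h1 : r * (X s * pderiv s q) = q * (X s * pderiv s r) := by
      linear_combination X s * hrq s
    have h2 := o.coeff_mul_of_add_of_degree_le (le_refl (o.toSyn (o.degree r))) (hle s q)
    have h3 := o.coeff_mul_of_add_of_degree_le (le_refl (o.toSyn (o.degree q))) (hle s r)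
    rw [h1, add_comm, h3, coeff_X_mul_pderiv, coeff_X_mul_pderiv] at h2
    have hr' := o.coeff_degree_ne_zero_iff.2 hr
    have hq' := o.coeff_degree_ne_zero_iff.2 hq
    have h4 : ((o.degree r s : ℕ) : F) = (o.degree q s : ℕ) := by
      apply mul_left_cancel₀ (mul_ne_zero hr' hq')
      linear_combination h2
    exact_mod_cast h4
  have hq' := o.coeff_degree_ne_zero_iff.2 hq
  -- This `c` cancels the coefficient of `p - c • q` at the leading exponent of `q`. The difference
  -- satisfies the same linear equations, so `key` forces it to vanish.
  set c : F := p.coeff (o.degree q) / q.coeff (o.degree q)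
  refine ⟨c, ?_⟩
  by_contra hne
  have hr : p - c • q ≠ 0 := sub_ne_zero.2 hne
  have hd := key (p - c • q) hr fun s => by
    rw [map_sub, Derivation.map_smul, sub_mul, mul_sub, h s, smul_mul_assoc, mul_smul_comm]
  have := o.coeff_degree_ne_zero_iff.2 hr
  rw [hd, coeff_sub, coeff_smul, smul_eq_mul, div_mul_cancel₀ _ hq', sub_self] at this
  exact this rfl

/-- Binary forms of the same positive degree with vanishing Jacobian are proportional. -/
theorem IsHomogeneous.exists_eq_smul_of_jacobian_eq_zero [CharZero F] {n : ℕ} (hn : n ≠ 0)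
    {p q : MvPolynomial (Fin 2) F} (hp : p.IsHomogeneous n) (hq : q.IsHomogeneous n) (hq0 : q ≠ 0)
    (h : pderiv 1 p * pderiv 0 q = pderiv 1 q * pderiv 0 p) : ∃ c : F, p = c • q := by
  have ep := hp.sum_X_mul_pderiv
  have eq := hq.sum_X_mul_pderiv
  rw [Fin.sum_univ_two, nsmul_eq_mul] at ep eq
  have hn' : (n : MvPolynomial (Fin 2) F) ≠ 0 := by exact_mod_cast hn
  -- Once multiplied by `n`, Euler's identity turns each equation into a variable times the
  -- Jacobian.
  refine exists_eq_smul_of_mul_pderiv_eq hq0 fun s => mul_left_cancel₀ hn' ?_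
  fin_cases s
  · simp only [Fin.zero_eta]
    linear_combination (-pderiv 0 q) * ep + pderiv 0 p * eq + X 1 * h
  · simp only [Fin.mk_one]
    linear_combination (-pderiv 1 q) * ep + pderiv 1 p * eq - X 0 * h

end MvPolynomial

namespace WeylA1

open MvPolynomial

variable {F : Type*} [Field F]

/-! ### The involution and the product seen through `Θ`. -/

theorem ofPoly_theta (u : WeylA1 F) : ofPoly (theta u) = u :=
  LinearEquiv.apply_symm_apply (LinearEquiv.ofBijective ofPoly ofPoly_bijective) u

theorem theta_ofPoly (p : MvPolynomial (Fin 2) F) : theta (ofPoly p) = p :=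
  ofPoly_bijective.1 (ofPoly_theta _)

theorem theta_mul (u v : WeylA1 F) : theta (u * v) = polyRep u (theta v) :=
  ofPoly_bijective.1 (by rw [ofPoly_theta, ofPoly_polyRep, ofPoly_theta])

theorem theta_one : theta (1 : WeylA1 F) = 1 := by
  simpa using theta_x_pow_mul_y_pow (F := F) 0 0

theorem exchange_pow (u : WeylA1 F) (n : ℕ) : exchange (u ^ n) = exchange u ^ n := by
  induction n with
  | zero => simpa using exchange_algebraMap (1 : F)
  | succ n ih => rw [pow_succ, exchange_mul, ih, ← pow_succ']

/-- Under `Θ`, the exchange involution interchanges the two variables. -/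
theorem theta_exchange (u : WeylA1 F) :
    theta (exchange u) = rename (Equiv.swap (0 : Fin 2) 1) (theta u) := by
  obtain ⟨p, rfl⟩ := ofPoly_bijective.2 u
  rw [theta_ofPoly]
  refine ofPoly_bijective.1 ?_
  rw [ofPoly_theta]
  induction p using MvPolynomial.induction_on' with
  | monomial m c =>
    rw [rename_monomial, ofPoly_monomial, ofPoly_monomial, map_smul, exchange_mul, exchange_pow,
      exchange_pow, exchange_x, exchange_y, Finsupp.mapDomain_equiv_apply,
      Finsupp.mapDomain_equiv_apply]
    simp
  | add p q hp hq => simp only [map_add, hp, hq]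

theorem polyRep_x (q : MvPolynomial (Fin 2) F) : polyRep x q = X 0 * q := by
  simp [polyRep]

theorem polyRep_y (q : MvPolynomial (Fin 2) F) : polyRep y q = X 1 * q + pderiv 0 q := by
  simp [polyRep]

theorem polyRep_x_pow (n : ℕ) (q : MvPolynomial (Fin 2) F) :
    polyRep (x ^ n) q = X 0 ^ n * q := by
  induction n with
  | zero => simp
  | succ n ih =>
    rw [pow_succ', map_mul, Module.End.mul_apply, ih, polyRep_x, pow_succ', mul_assoc]

/-- Multiplication by `X 1` commutes with `∂_0`, so `(X 1 + ∂_0)^n` expands binomially. Its `k`-th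
term lowers degree by `2k`; the remainder starts at `k = 2`. -/
theorem polyRep_y_pow_mem (n : ℕ) {j : ℤ} {q : MvPolynomial (Fin 2) F}
    (hq : q ∈ degLE (Fin 2) F j) :
    polyRep (y ^ n) q - X 1 ^ n * q - pderiv 1 (X 1 ^ n) * pderiv 0 q ∈
      degLE (Fin 2) F (n + j - 4) := by
  induction n with
  | zero => simp
  | succ n ih =>
    set A := polyRep (y ^ n) q - X 1 ^ n * q - pderiv 1 (X 1 ^ n) * pderiv 0 q with hA
    have h10 : pderiv 0 (X 1 : MvPolynomial (Fin 2) F) = 0 := pderiv_X_of_ne (by decide)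
    have e1 : polyRep (y ^ n) q = A + X 1 ^ n * q + pderiv 1 (X 1 ^ n) * pderiv 0 q := by
      rw [hA]; ring
    have e2 : polyRep (y ^ (n + 1)) q - X 1 ^ (n + 1) * q -
        pderiv 1 (X 1 ^ (n + 1)) * pderiv 0 q =
        X 1 * A + pderiv 0 A + (n : F) • (X 1 ^ (n - 1) * pderiv 0 (pderiv 0 q)) := by
      rw [pow_succ', map_mul, Module.End.mul_apply, e1, polyRep_y, smul_eq_C_mul, map_natCast]
      simp only [map_add, Derivation.leibniz, Derivation.leibniz_pow, h10, pderiv_X_self,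
        smul_eq_mul, smul_zero, mul_zero, add_zero, nsmul_eq_mul, mul_one,
        Derivation.map_natCast, pow_succ']
      ring
    rw [e2]
    refine Submodule.add_mem _ (Submodule.add_mem _ ?_ ?_) ?_
    · exact degLE_mono (by push_cast; omega)
        (mul_mem_degLE (i := 1) (by simpa using X_pow_mem_degLE (F := F) (1 : Fin 2) 1) ih)
    · exact degLE_mono (by push_cast; omega) (pderiv_mem_degLE 0 ih)
    · rcases Nat.eq_zero_or_pos n with rfl | hn
      · simp
      · exact Submodule.smul_mem _ _ (degLE_mono (by omega)
          (mul_mem_degLE (X_pow_mem_degLE 1 (n - 1)) (pderiv_mem_degLE 0 (pderiv_mem_degLE 0 hq))))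

/-- The first two terms of the product of `A₁(F)` transported to `F[X, Y]` along `Θ`. -/
theorem theta_mul_mem {i j : ℤ} {u v : WeylA1 F} (hu : theta u ∈ degLE (Fin 2) F i)
    (hv : theta v ∈ degLE (Fin 2) F j) :
    theta (u * v) - theta u * theta v - pderiv 1 (theta u) * pderiv 0 (theta v) ∈
      degLE (Fin 2) F (i + j - 4) := by
  let L : MvPolynomial (Fin 2) F →ₗ[F] MvPolynomial (Fin 2) F :=
    (polyRep.toLinearMap.flip (theta v)) ∘ₗ ofPoly - LinearMap.mulRight F (theta v) -
      LinearMap.mulRight F (pderiv 0 (theta v)) ∘ₗ (pderiv 1).toLinearMap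
  have hL : ∀ p, L p = polyRep (ofPoly p) (theta v) - p * theta v -
      pderiv 1 p * pderiv 0 (theta v) := fun p => rfl
  have := map_mem_degLE (k := i + j - 4) L (fun m hm => ?_) hu
  · rwa [hL, ofPoly_theta, ← theta_mul] at this
  · have hm' : (monomial m 1 : MvPolynomial (Fin 2) F) = X 0 ^ m 0 * X 1 ^ m 1 := by
      rw [monomial_eq, Finsupp.prod_fintype _ _ (by simp)]
      simp [Fin.prod_univ_two]
    have h01 : pderiv 1 (X 0 : MvPolynomial (Fin 2) F) = 0 := pderiv_X_of_ne (by decide)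
    -- Powers of `x` act by plain multiplication and `∂_1` kills `X 0`, so the power of `X 0`
    -- factors out.
    have e : L (monomial m 1) = X 0 ^ m 0 * (polyRep (y ^ m 1) (theta v) - X 1 ^ m 1 * theta v -
        pderiv 1 (X 1 ^ m 1) * pderiv 0 (theta v)) := by
      rw [hL, ofPoly_monomial, one_smul, map_mul, Module.End.mul_apply, polyRep_x_pow, hm',
        Derivation.leibniz, Derivation.leibniz_pow (pderiv 1) (X 0), h01]
      simp only [smul_zero, smul_eq_mul, add_zero, mul_zero]
      ring
    rw [e]
    have hd : m.degree = m 0 + m 1 := by simp [Finsupp.degree_eq_sum]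
    exact degLE_mono (by omega) (mul_mem_degLE (X_pow_mem_degLE 0 _) (polyRep_y_pow_mem (m 1) hv))

theorem theta_commutator_mem {i j : ℤ} {u v : WeylA1 F} (hu : theta u ∈ degLE (Fin 2) F i)
    (hv : theta v ∈ degLE (Fin 2) F j) :
    theta (u * v - v * u) - (pderiv 1 (theta u) * pderiv 0 (theta v) -
      pderiv 1 (theta v) * pderiv 0 (theta u)) ∈ degLE (Fin 2) F (i + j - 4) := by
  have h1 := theta_mul_mem hu hv
  have h2 := theta_mul_mem hv hu
  rw [add_comm j i] at h2
  have h3 := Submodule.sub_mem _ h1 h2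
  rw [map_sub]
  convert h3 using 1
  ring

/-! ### Leading forms and their symmetry. -/

theorem nuExp_one_one (m : Fin 2 →₀ ℕ) : nuExp 1 1 m = (m.degree : ℤ) := by
  simp [nuExp, Finsupp.degree_eq_sum]

theorem coeff_leadPoly (r s : ℤ) (p : MvPolynomial (Fin 2) F) (m : Fin 2 →₀ ℕ) :
    (leadPoly r s p).coeff m =
      if (nuExp r s m : WithBot ℤ) = nuPoly r s p then p.coeff m else 0 := by
  classical
  rw [leadPoly, coeff_sum]
  simp only [coeff_monomial, Finset.sum_ite_eq', Finset.mem_filter, mem_support_iff]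
  by_cases h : p.coeff m = 0 <;> simp [h]

/-- If `[P^*, P] = 1` and `P` has degree greater than `1`, then the leading term of `P` is symmetric
or antisymmetric. -/
theorem isSymmetric_or_isAntisymmetric_lead [CharZero F] {P : WeylA1 F} (hdeg : 1 < nu 1 1 P)
    (hP : exchange P * P - P * exchange P = 1) :
    IsSymmetric (theta.symm (lead 1 1 P)) ∨ IsAntisymmetric (theta.symm (lead 1 1 P)) := by
  set p := theta P with hp
  set s : Fin 2 → Fin 2 := ⇑(Equiv.swap (0 : Fin 2) 1) with hs
  have hs' : theta (exchange P) = rename s p := theta_exchange P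
  obtain ⟨k, hk⟩ := WithBot.ne_bot_iff_exists.1 (ne_bot_of_gt hdeg)
  have hk' : nuPoly 1 1 p = (k : WithBot ℤ) := hk.symm
  have hk1 : 1 < k := by rw [← hk] at hdeg; exact_mod_cast hdeg
  lift k to ℕ using by omega with n
  have hpn : p ∈ degLE (Fin 2) F n := fun m hm => by
    have h : (nuExp 1 1 m : WithBot ℤ) ≤ nuPoly 1 1 p :=
      Finset.le_sup (f := fun m => (nuExp 1 1 m : WithBot ℤ)) (mem_support_iff.2 hm)
    rw [hk', nuExp_one_one] at h
    exact_mod_cast h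
  set l := lead 1 1 P with hl
  have hcoeff : ∀ m, l.coeff m = if m.degree = n then p.coeff m else 0 := fun m => by
    rw [hl, lead, coeff_leadPoly, ← hp, hk', nuExp_one_one]
    norm_cast
  have hl0 : l ≠ 0 := by
    have hne : p.support.Nonempty := by
      rw [Finset.nonempty_iff_ne_empty]
      rintro h
      simp [nuPoly, h] at hk'
    obtain ⟨m, hm, hmax⟩ := Finset.exists_mem_eq_sup p.support hne
      fun m => (nuExp 1 1 m : WithBot ℤ)
    have h : (nuExp 1 1 m : WithBot ℤ) = ((n : ℤ) : WithBot ℤ) := by rw [← hk', nuPoly, hmax]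
    rw [nuExp_one_one] at h
    intro h0
    have h1 := hcoeff m
    rw [if_pos (by exact_mod_cast h), h0, coeff_zero] at h1
    exact mem_support_iff.1 hm h1.symm
  have hlhom : l.IsHomogeneous n := fun m hm => by
    rw [hcoeff] at hm
    have h := (ite_ne_right_iff.1 hm).1
    rwa [Finsupp.degree_eq_weight_one] at h
  have hrest : p - l ∈ degLE (Fin 2) F (n - 1) := fun m hm => by
    rw [coeff_sub, hcoeff] at hm
    by_cases h : m.degree = n
    · simp [h] at hm
    · have := hpn m (by simpa [h] using hm)
      omega
  have hslhom : (rename s l).IsHomogeneous n := hlhom.rename_isHomogeneous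
  have hsrest : rename s p - rename s l ∈ degLE (Fin 2) F (n - 1) := by
    rw [← map_sub]; exact rename_mem_degLE s hrest
  have hjac : pderiv 1 (rename s l) * pderiv 0 l = pderiv 1 l * pderiv 0 (rename s l) := by
    rw [← sub_eq_zero]
    -- The Jacobian has degree `2n - 2`, so a bound of `2n - 3` kills it. The constant `1` meets
    -- this bound exactly because `n ≥ 2`.
    refine IsHomogeneous.eq_zero_of_mem_degLE (n := (n - 1) + (n - 1)) (k := 2 * n - 3)
      ((hslhom.pderiv.mul hlhom.pderiv).sub (hlhom.pderiv.mul hslhom.pderiv)) ?_ (by omega)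
    have h1 := theta_commutator_mem (u := exchange P) (v := P) (i := n) (j := n)
      (by rw [hs']; exact rename_mem_degLE s hpn) hpn
    rw [hP, theta_one, hs', ← hp] at h1
    have h2 : (1 : MvPolynomial (Fin 2) F) ∈ degLE (Fin 2) F (2 * n - 3) :=
      degLE_mono (k := 0) (by omega) (by simpa using X_pow_mem_degLE (F := F) (0 : Fin 2) 0)
    -- Replacing a polynomial by its leading form changes a product of derivatives only in degrees
    -- at most `2n - 3`.
    have h3 : ∀ (a b : Fin 2) {f g f' g' : MvPolynomial (Fin 2) F}, f ∈ degLE (Fin 2) F n →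
        g' ∈ degLE (Fin 2) F n → f - f' ∈ degLE (Fin 2) F (n - 1) →
        g - g' ∈ degLE (Fin 2) F (n - 1) →
        pderiv a f * pderiv b g - pderiv a f' * pderiv b g' ∈ degLE (Fin 2) F (2 * n - 3) := by
      intro a b f g f' g' hf hg' hff hgg
      have e : pderiv a f * pderiv b g - pderiv a f' * pderiv b g' =
          pderiv a f * pderiv b (g - g') + pderiv a (f - f') * pderiv b g' := by
        simp only [map_sub]; ring
      rw [e]
      exact Submodule.add_mem _
        (degLE_mono (by omega) (mul_mem_degLE (pderiv_mem_degLE a hf) (pderiv_mem_degLE b hgg)))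
        (degLE_mono (by omega) (mul_mem_degLE (pderiv_mem_degLE a hff) (pderiv_mem_degLE b hg')))
    have h4 := h3 1 0 (rename_mem_degLE s hpn) hlhom.mem_degLE hsrest hrest
    have h5 := h3 1 0 hpn hslhom.mem_degLE hrest hsrest
    have h6 := Submodule.sub_mem _ (Submodule.sub_mem _ (Submodule.sub_mem _ h2
      (degLE_mono (by omega) h1)) h4) (Submodule.neg_mem _ h5)
    convert h6 using 1
    ring
  obtain ⟨c, hc⟩ := hslhom.exists_eq_smul_of_jacobian_eq_zero (by omega) hlhom hl0 hjac
  have hss : rename s (rename s l) = l := by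
    rw [rename_rename]
    have : s ∘ s = id := by ext a; simp [hs]
    rw [this, rename_id_apply]
  have hc2 : (c * c) • l = (1 : F) • l := by
    rw [mul_smul, ← hc, ← map_smul, ← hc, hss, one_smul]
  have hexch : exchange (theta.symm l) = c • theta.symm l := by
    apply theta.injective
    rw [theta_exchange, map_smul, LinearEquiv.apply_symm_apply]
    exact hc
  rcases mul_self_eq_one_iff.1 (smul_left_injective F hl0 hc2) with rfl | rfl
  · left; rw [IsSymmetric, hexch, one_smul]
  · right; rw [IsAntisymmetric, hexch]; module

end WeylA1

theorem mainTheorem4 {F : Type*} [Field F] [CharZero F]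
    (f : WeylA1 F →ₐ[F] WeylA1 F) (hf : WeylA1.IsAlphaEndomorphism f)
    (hdeg : 1 < WeylA1.endDegree f) (P : WeylA1 F) (hP : f WeylA1.x = P) :
    f WeylA1.y = WeylA1.exchange P ∧
      (WeylA1.IsSymmetric (WeylA1.theta.symm (WeylA1.lead 1 1 P)) ∨
        WeylA1.IsAntisymmetric (WeylA1.theta.symm (WeylA1.lead 1 1 P))) := by
  subst hP
  have hy : f WeylA1.y = WeylA1.exchange (f WeylA1.x) := by
    rw [← hf, WeylA1.exchange_x]
  refine ⟨hy, WeylA1.isSymmetric_or_isAntisymmetric_lead hdeg ?_⟩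
  rw [← hy, ← map_mul, ← map_mul, WeylA1.y_mul_x, map_add, map_one, add_sub_cancel_left]
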